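/- Let $m,n\ge 1$ with $m$ odd. A real tensor of order $m$ and dimension $n$ is an array $\mathcal T=(t_{i_1\cdots i_m})$ of real numbers, $i_1,\dots,i_m\in[n]=\{1,\dots,n\}$; its diagonal entries are the $t_{ii\cdots i}$, and $|\mathcal T|=(|t_{i_1\cdots i_m}|)$. A real number $\mu$ is an H-eigenvalue of $\mathcal T$ if there is a nonzero $x\in\mathbb R^n$ with $$\sum_{i_2,\dots,i_m=1}^n t_{i i_2\cdots i_m}x_{i_2}\cdots x_{i_m}=\mu\, x_i^{m-1}\qquad\text{for all } i\in[n],$$ and $\lambda(\mathcal T)$ denotes the largest H-eigenvalue of $\mathcal T$. Let $\mathcal A=\mathcal D-\mathcal C$ be a tensor of order $m$ and dimension $n$, where $\mathcal D$ is a diagonal tensor (all off-diagonal entries are zero) with nonnegative entries, and $\mathcal C=(c_{i_1\cdots i_m})$ is a tensor with nonnegative entries whose diagonal entries are all zero. Suppose that $V\subset[n]$ is a nonempty proper subset with respect to which $\mathcal C$ is weakly odd-bipartite, i.e. $c_{i_1\cdots i_m}=0$ whenever the number of positions $j\in[m]$ with $i_j\in V$ is even, and that $c_{i i_2\cdots i_m}=0$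 for all $i\in V$ and all $i_2,\dots,i_m\in[n]$. If $\mathcal A$ and $|\mathcal A|$ have H-eigenvalues, then both have a largest H-eigenvalue and $$\lambda(\mathcal A)=\lambda(|\mathcal A|).$$ Moreover, if $m\ge 3$, then $\mathcal A$ and $|\mathcal A|$ always have H-eigenvalues. -/

import Mathlib

/-- Real tensors of order `m` and dimension `n`, given by their entries. -/
abbrev RTensor (m n : ℕ) : Type := (Fin m → Fin n) → ℝ

namespace RTensor

variable {m n : ℕ}

/-- The absolute tensor, obtained by taking the absolute value of every entry. -/
def absTensor (T : RTensor m n) : RTensor m n := fun idx => |T idx|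

/-- A multi-index is diagonal if all its components coincide. -/
def DiagIndex (idx : Fin m → Fin n) : Prop := ∃ i, ∀ j, idx j = i

/-- Entrywise nonnegative tensors. -/
def Nonneg (T : RTensor m n) : Prop := ∀ idx, 0 ≤ T idx

/-- Diagonal tensors: all off-diagonal entries vanish. -/
def IsDiagonal (T : RTensor m n) : Prop := ∀ idx, ¬ DiagIndex idx → T idx = 0

/-- Tensors all of whose diagonal entries vanish. -/
def ZeroDiagonal (T : RTensor m n) : Prop := ∀ idx, DiagIndex idx → T idx = 0

/-- The vector `T x^(m-1)`: its `i`-th component is the sum, over all multi-indices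
`(i₁, …, iₘ)` with first index `i₁ = i`, of `T (i₁, …, iₘ) * x i₂ * ⋯ * x iₘ`. -/
def applyVec [NeZero m] (T : RTensor m n) (x : Fin n → ℝ) (i : Fin n) : ℝ :=
  ∑ idx : Fin m → Fin n with idx 0 = i, T idx * ∏ j ∈ Finset.univ.erase (0 : Fin m), x (idx j)

/-- `μ` is an H-eigenvalue of `T`: some nonzero real `x` satisfies `T x^(m-1) = μ x^[m-1]`. -/
def IsHEigenvalue [NeZero m] (T : RTensor m n) (μ : ℝ) : Prop :=
  ∃ x : Fin n → ℝ, x ≠ 0 ∧ ∀ i, T.applyVec x i = μ * x i ^ (m - 1)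

/-- The set of H-eigenvalues of `T`. -/
def hEigenvalues [NeZero m] (T : RTensor m n) : Set ℝ := {μ | T.IsHEigenvalue μ}

/-- `T` is weakly odd-bipartite with respect to `V`: `V` is a nonempty proper set of indices and
an entry of `T` vanishes whenever the number of its indices in `V`, counted with repetition,
is even. -/
def WeaklyOddBipartite (T : RTensor m n) (V : Finset (Fin n)) : Prop :=
  V.Nonempty ∧ V ≠ Finset.univ ∧
    ∀ idx : Fin m → Fin n, Even (Finset.card {j : Fin m | idx j ∈ V}) → T idx = 0

end RTensor

namespace RTensor

variable {m n : ℕ}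

/-! Here `|A| = D + C`, and negating the coordinates in `V` exchanges eigenvectors of `D - C` and `D
+ C` with the same eigenvalue (`applyVec_sub_flipSign`): as `m - 1` is even, `D` and the powers `x i
^ (m - 1)` do not see the signs, while each surviving term of `C` changes sign. So the two spectra
coincide. A spectrum is compact, hence has a maximum once nonempty; for `m ≥ 3` a coordinate vector
off `V` is an eigenvector. -/

/-- The vector obtained from `x` by changing the signs of the components in `V`. -/
def flipSign (V : Finset (Fin n)) (x : Fin n → ℝ) (i : Fin n) : ℝ :=
  if i ∈ V then -x i else x i

lemma flipSign_flipSign (V : Finset (Fin n)) (x : Fin n → ℝ) :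
    flipSign V (flipSign V x) = x := by
  ext i
  by_cases h : i ∈ V <;> simp [flipSign, h]

lemma flipSign_ne_zero {V : Finset (Fin n)} {x : Fin n → ℝ} (hx : x ≠ 0) :
    flipSign V x ≠ 0 := by
  intro h
  apply hx
  rw [← flipSign_flipSign V x, h]
  ext i
  simp [flipSign]

lemma flipSign_pow {k : ℕ} (hk : Even k) (V : Finset (Fin n)) (x : Fin n → ℝ) (i : Fin n) :
    flipSign V x i ^ k = x i ^ k := by
  by_cases h : i ∈ V <;> simp [flipSign, h, hk.neg_pow]

lemma prod_flipSign (V : Finset (Fin n)) (x : Fin n → ℝ) (s : Finset (Fin m))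
    (idx : Fin m → Fin n) :
    ∏ j ∈ s, flipSign V x (idx j) =
      (-1) ^ (s.filter fun j => idx j ∈ V).card * ∏ j ∈ s, x (idx j) := by
  have h : ∀ j ∈ s, flipSign V x (idx j) = (if idx j ∈ V then -1 else 1) * x (idx j) := by
    intro j _
    by_cases h : idx j ∈ V <;> simp [flipSign, h]
  rw [Finset.prod_congr rfl h, Finset.prod_mul_distrib, Finset.prod_ite]
  simp

lemma absTensor_sub_eq_add {D C : RTensor m n} (hD : D.IsDiagonal) (hD0 : D.Nonneg)
    (hC0 : C.Nonneg) (hCdiag : C.ZeroDiagonal) : (D - C).absTensor = D + C := by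
  ext idx
  by_cases h : DiagIndex idx
  · simp [absTensor, hCdiag idx h, abs_of_nonneg (hD0 idx)]
  · simp [absTensor, hD idx h, abs_of_nonneg (hC0 idx)]

/-- Changing signs on `V` carries `D - C` to `D + C`. -/
lemma applyVec_sub_flipSign [NeZero m] (hm : Odd m) {D C : RTensor m n} (hD : D.IsDiagonal)
    (hCdiag : C.ZeroDiagonal) {V : Finset (Fin n)} (hV : C.WeaklyOddBipartite V)
    (hslice : ∀ idx : Fin m → Fin n, idx 0 ∈ V → C idx = 0) (x : Fin n → ℝ) :
    (D - C).applyVec (flipSign V x) = (D + C).applyVec x := by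
  ext i
  refine Finset.sum_congr rfl fun idx _ => ?_
  rw [prod_flipSign, ← mul_assoc]
  congr 1
  by_cases h : DiagIndex idx
  · have hev : Even ((Finset.univ.erase (0 : Fin m)).filter fun j => idx j ∈ V).card := by
      obtain ⟨k, hk⟩ := h
      by_cases hkV : k ∈ V
      -- All `m - 1` trailing indices lie in `V`.
      · simpa [hk, hkV] using hm.tsub_odd odd_one
      · simp [hk, hkV]
    simp [hCdiag idx h, hev.neg_one_pow]
  · rw [Pi.sub_apply, Pi.add_apply, hD idx h]
    by_cases hC : C idx = 0
    · simp [hC]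
    -- The odd number of indices in `V` then all sit in trailing positions, where they contribute
    -- signs.
    · have h0 : idx 0 ∉ V := fun h0 => hC (hslice idx h0)
      have hodd : Odd ((Finset.univ.erase (0 : Fin m)).filter fun j => idx j ∈ V).card := by
        rw [Finset.filter_erase, Finset.erase_eq_of_notMem (by simpa using h0)]
        exact Nat.not_even_iff_odd.mp fun he => hC (hV.2.2 idx he)
      simp [hodd.neg_one_pow]

lemma hEigenvalues_sub_eq_add [NeZero m] (hm : Odd m) {D C : RTensor m n} (hD : D.IsDiagonal)
    (hCdiag : C.ZeroDiagonal) {V : Finset (Fin n)} (hV : C.WeaklyOddBipartite V)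
    (hslice : ∀ idx : Fin m → Fin n, idx 0 ∈ V → C idx = 0) :
    (D - C).hEigenvalues = (D + C).hEigenvalues := by
  have hev : Even (m - 1) := hm.tsub_odd odd_one
  ext μ
  constructor
  · rintro ⟨x, hx, h⟩
    refine ⟨flipSign V x, flipSign_ne_zero hx, fun i => ?_⟩
    rw [← applyVec_sub_flipSign hm hD hCdiag hV hslice, flipSign_flipSign, flipSign_pow hev, h]
  · rintro ⟨x, hx, h⟩
    refine ⟨flipSign V x, flipSign_ne_zero hx, fun i => ?_⟩
    rw [applyVec_sub_flipSign hm hD hCdiag hV hslice, flipSign_pow hev, h]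

lemma applyVec_smul [NeZero m] (T : RTensor m n) (c : ℝ) (x : Fin n → ℝ) (i : Fin n) :
    T.applyVec (c • x) i = c ^ (m - 1) * T.applyVec x i := by
  simp only [applyVec, Finset.mul_sum, Pi.smul_apply, smul_eq_mul, Finset.prod_mul_distrib,
    Finset.prod_const, Finset.card_erase_of_mem (Finset.mem_univ _), Finset.card_univ,
    Fintype.card_fin]
  exact Finset.sum_congr rfl fun idx _ => by ring

lemma continuous_applyVec [NeZero m] (T : RTensor m n) (i : Fin n) :
    Continuous fun x => T.applyVec x i := by
  unfold applyVec
  fun_prop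

lemma abs_applyVec_le [NeZero m] (T : RTensor m n) {x : Fin n → ℝ} (hx : ‖x‖ ≤ 1) (i : Fin n) :
    |T.applyVec x i| ≤ ∑ idx, |T idx| := by
  refine (Finset.abs_sum_le_sum_abs _ _).trans ?_
  refine (Finset.sum_le_sum_of_subset_of_nonneg (Finset.subset_univ _)
    fun _ _ _ => abs_nonneg _).trans (Finset.sum_le_sum fun idx _ => ?_)
  rw [abs_mul, Finset.abs_prod]
  refine mul_le_of_le_one_right (abs_nonneg _) (Finset.prod_le_one (fun _ _ => abs_nonneg _) ?_)
  exact fun j _ => (norm_le_pi_norm x (idx j)).trans hx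

lemma IsHEigenvalue.exists_norm_eq_one [NeZero m] {T : RTensor m n} {μ : ℝ}
    (h : T.IsHEigenvalue μ) :
    ∃ x : Fin n → ℝ, ‖x‖ = 1 ∧ ∀ i, T.applyVec x i = μ * x i ^ (m - 1) := by
  obtain ⟨x, hx, h⟩ := h
  refine ⟨‖x‖⁻¹ • x, norm_smul_inv_norm hx, fun i => ?_⟩
  rw [applyVec_smul, h, Pi.smul_apply, smul_eq_mul, mul_pow]
  ring

/-- Read the equation at a coordinate where the sup norm of a normalized eigenvector is attained. -/
lemma IsHEigenvalue.abs_le [NeZero m] {T : RTensor m n} {μ : ℝ} (h : T.IsHEigenvalue μ) :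
    |μ| ≤ ∑ idx, |T idx| := by
  obtain ⟨x, hx, h⟩ := h.exists_norm_eq_one
  obtain ⟨i, hi⟩ : ∃ i, ‖x i‖ = 1 := by
    have : Nonempty (Fin n) := by
      by_contra hn
      rw [not_nonempty_iff] at hn
      simp [Subsingleton.elim x 0] at hx
    obtain ⟨i, hi⟩ := Finite.exists_max fun i => ‖x i‖
    refine ⟨i, le_antisymm (hx ▸ norm_le_pi_norm x i) ?_⟩
    rw [← hx]
    exact (pi_norm_le_iff_of_nonneg (norm_nonneg _)).2 hi
  have hT := abs_applyVec_le T hx.le i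
  rwa [h, abs_mul, abs_pow, ← Real.norm_eq_abs (x i), hi, one_pow, mul_one] at hT

/-- The spectrum is the projection of a compact set of pairs (eigenvector, eigenvalue); normalizing
to the unit sphere keeps limits of eigenvectors nonzero. -/
lemma isCompact_hEigenvalues [NeZero m] (T : RTensor m n) : IsCompact T.hEigenvalues := by
  set K : Set ((Fin n → ℝ) × ℝ) :=
    (Metric.sphere 0 1 ×ˢ Metric.closedBall 0 (∑ idx, |T idx|)) ∩
      {p | ∀ i, T.applyVec p.1 i = p.2 * p.1 i ^ (m - 1)}
  have hKc : IsCompact K := by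
    refine ((isCompact_sphere _ _).prod (isCompact_closedBall _ _)).inter_right ?_
    rw [Set.ofPred_forall]
    refine isClosed_iInter fun i => isClosed_eq ((continuous_applyVec T i).comp continuous_fst) ?_
    fun_prop
  convert hKc.image continuous_snd
  ext μ
  constructor
  · intro h
    obtain ⟨x, hx, hxe⟩ := IsHEigenvalue.exists_norm_eq_one h
    exact ⟨(x, μ), ⟨⟨by simpa using hx, by simpa using IsHEigenvalue.abs_le h⟩, hxe⟩, rfl⟩
  · rintro ⟨⟨x, ν⟩, ⟨⟨hx, -⟩, hxe⟩, rfl⟩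
    refine ⟨x, ?_, hxe⟩
    rintro rfl
    simp at hx

/-- A unit vector with index off `V` is an eigenvector of `D + C`. -/
lemma hEigenvalues_add_nonempty [NeZero m] (hm3 : 3 ≤ m) {D C : RTensor m n}
    (hD : D.IsDiagonal) {V : Finset (Fin n)} (hV : C.WeaklyOddBipartite V)
    (hslice : ∀ idx : Fin m → Fin n, idx 0 ∈ V → C idx = 0) :
    (D + C).hEigenvalues.Nonempty := by
  obtain ⟨k, hk⟩ : ∃ k, k ∉ V := by
    by_contra! h
    exact hV.2.1 (Finset.eq_univ_iff_forall.2 h)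
  have hvanish : ∀ idx : Fin m → Fin n, idx ≠ (fun _ => k) →
      (D + C) idx * ∏ j ∈ Finset.univ.erase (0 : Fin m),
        (Pi.single k 1 : Fin n → ℝ) (idx j) = 0 := by
    intro idx hidx
    by_cases hall : ∀ j ∈ Finset.univ.erase (0 : Fin m), idx j = k
    · have hj : ∀ j, j ≠ 0 → idx j = k := fun j hj => hall j (by simp [hj])
      have h0 : idx 0 ≠ k := fun h0 => hidx <| funext fun j => by
        by_cases h : j = 0
        · rw [h, h0]
        · exact hj j h
      have hDz : D idx = 0 := by
        refine hD idx ?_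
        rintro ⟨l, hl⟩
        -- A second position is needed to force the diagonal value to be `k`; for `m = 1` every
        -- index is diagonal.
        have h1 := hj ⟨1, by omega⟩ (by simp [Fin.ext_iff])
        exact h0 ((hl 0).trans ((hl _).symm.trans h1))
      have hCz : C idx = 0 := by
        by_cases h0V : idx 0 ∈ V
        · exact hslice idx h0V
        · have hempty : ∀ j, idx j ∉ V := fun j => by
            by_cases h : j = 0
            · rwa [h]
            · rwa [hj j h]
          -- No index lies in `V`, and zero is even.
          exact hV.2.2 idx (by simp [hempty])
      simp [hDz, hCz]
    · push Not at hall
      obtain ⟨j, hj, hjk⟩ := hall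
      rw [Finset.prod_eq_zero hj (by simp [hjk]), mul_zero]
  refine ⟨(D + C) fun _ => k, Pi.single k 1, by simp, fun i => ?_⟩
  by_cases hi : i = k
  · subst hi
    rw [applyVec, Finset.sum_eq_single_of_mem (fun _ => i) (by simp)
      fun idx _ h => hvanish idx h]
    simp
  · rw [applyVec, Finset.sum_eq_zero, Pi.single_eq_of_ne hi, zero_pow (by omega), mul_zero]
    intro idx hidx
    refine hvanish idx ?_
    rintro rfl
    exact hi (by simpa using (Finset.mem_filter.1 hidx).2.symm)

end RTensor

theorem mainTheorem7 (m n : ℕ) [NeZero m] (hm : Odd m) (A D C : RTensor m n)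
    (hD : D.IsDiagonal) (hD0 : D.Nonneg) (hC0 : C.Nonneg) (hCdiag : C.ZeroDiagonal)
    (hA : A = D - C) (V : Finset (Fin n)) (hV : C.WeaklyOddBipartite V)
    (hslice : ∀ idx : Fin m → Fin n, idx 0 ∈ V → C idx = 0) :
    (A.hEigenvalues.Nonempty → A.absTensor.hEigenvalues.Nonempty →
      ∃ μ : ℝ, IsGreatest A.hEigenvalues μ ∧ IsGreatest A.absTensor.hEigenvalues μ) ∧
    (3 ≤ m → A.hEigenvalues.Nonempty ∧ A.absTensor.hEigenvalues.Nonempty) := by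
  subst hA
  rw [RTensor.absTensor_sub_eq_add hD hD0 hC0 hCdiag,
    RTensor.hEigenvalues_sub_eq_add hm hD hCdiag hV hslice]
  constructor
  · intro h _
    obtain ⟨μ, hμ⟩ := (RTensor.isCompact_hEigenvalues (D + C)).exists_isGreatest h
    exact ⟨μ, hμ, hμ⟩
  · intro hm3
    have h := RTensor.hEigenvalues_add_nonempty hm3 hD hV hslice
    exact ⟨h, h⟩
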